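/- Let $d\ge 1$ be an integer, let $\psi(x)=e^{-|x|^2/4}$ for $x\in\mathbb R^d$, and let $e^{it\Delta}\psi$ denote the solution at time $t$ of the free Schrödinger equation $i\partial_t u=-\Delta u$ on $\mathbb R^d$ with initial data $\psi$. For $\lambda>0$ put $$\mu(\lambda)=\bigl|\{(t,x)\in\mathbb R\times\mathbb R^d:\ |e^{it\Delta}\psi(x)|^2>\lambda\}\bigr|$$ (Lebesgue measure). Let $c\ge 1+\frac{3}{2d}$, $v(k)=e^{-ck}\mu(e^{-k})$ and $V(z)=\int_0^\infty e^{-kz}v(k)\,dk$ for $z\in\mathbb H=\{z\in\mathbb C:\operatorname{Re}z>0\}$. Then $\mu(\lambda)<\infty$ for every $\lambda>0$, the integral defining $V(z)$ converges absolutely for every $z\in\mathbb H$, and $V$ belongs to the Hardy space $H^2(\mathbb H)$, that is, $V$ is analytic in $\mathbb H$ and $$\sup_{x>0}\int_{\mathbb R}|V(x+iy)|^2\,dy<\infty .$$ Moreover $V$ is an outer function: the boundary values $V(iy)=\lim_{x\downarrow0}V(x+iy)$ exist and are non-zero for almost every $y\in\mathbb R$, $\int_{\mathbb R}\bigl|\log|V(iy)|\bigr|\frac{dy}{1+y^2}<\infty$,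 and $|V(z)|=|O_V(z)|$ for all $z\in\mathbb H$, where $$O_V(z)=\exp\Bigl\{\int_{\mathbb R}\log|V(it)|\Bigl[\frac1{z-it}-\frac{it}{1+t^2}\Bigr]\frac{dt}{\pi}\Bigr\}.$$ -/

import Mathlib

open MeasureTheory Filter Topology
open scoped ENNReal FourierTransform

noncomputable section

/-- The free Schrödinger propagator `e^{itΔ}` on `ℝ^d`, as a Fourier multiplier (for `f` with `f` and
its Fourier transform integrable). With the normalization `𝓕 f ξ = ∫ e^{-2πi⟨x,ξ⟩} f x dx`, the
Laplacian is multiplication by `-4π²|ξ|²`. -/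
def schrodingerPropagator {d : ℕ} (t : ℝ) (f : EuclideanSpace ℝ (Fin d) → ℂ) :
    EuclideanSpace ℝ (Fin d) → ℂ :=
  𝓕⁻ (fun ξ : EuclideanSpace ℝ (Fin d) =>
    Complex.exp (-(4 * (Real.pi : ℂ) ^ 2 * Complex.I * (t : ℂ) * ((‖ξ‖ ^ 2 : ℝ) : ℂ))) * 𝓕 f ξ)

/-- The Gaussian `ψ(x) = exp(-|x|²/4)`. -/
def gaussianData (d : ℕ) (x : EuclideanSpace ℝ (Fin d)) : ℂ :=
  ((Real.exp (-(‖x‖ ^ 2) / 4) : ℝ) : ℂ)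

/-- The distribution function
`μ(lam) = |{(t,x) ∈ ℝ × ℝ^d : |e^{itΔ}ψ(x)|² > lam}|`. -/
def gaussianDistribution (d : ℕ) (lam : ℝ) : ℝ≥0∞ :=
  volume {p : ℝ × EuclideanSpace ℝ (Fin d) |
    lam < ‖schrodingerPropagator p.1 (gaussianData d) p.2‖ ^ 2}

/-- `v(k) = e^{-ck} μ(e^{-k})`. -/
def weightFunction (d : ℕ) (c : ℝ) (k : ℝ) : ℝ :=
  Real.exp (-(c * k)) * (gaussianDistribution d (Real.exp (-k))).toReal

/-- The Laplace transform `V(z) = ∫₀^∞ e^{-kz} v(k) dk`. -/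
def laplaceTransform (v : ℝ → ℝ) (z : ℂ) : ℂ :=
  ∫ k in Set.Ioi (0 : ℝ), Complex.exp (-((k : ℂ) * z)) * (v k : ℂ)

/-- The open right half-plane. -/
def rightHalfPlane : Set ℂ := {z : ℂ | 0 < z.re}

/-- Membership in the Hardy space `H²` of the right half-plane. -/
def MemHardyTwo (V : ℂ → ℂ) : Prop :=
  DifferentiableOn ℂ V rightHalfPlane ∧
    (⨆ (x : ℝ) (_ : 0 < x), ∫⁻ y : ℝ, ‖V ((x : ℂ) + (y : ℂ) * Complex.I)‖ₑ ^ 2) < ⊤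

/-- `b` is (a representative of) the boundary function `y ↦ V(iy) = lim_{x ↓ 0} V(x + iy)`, a.e. -/
def IsBoundaryValue (V : ℂ → ℂ) (b : ℝ → ℂ) : Prop :=
  ∀ᵐ y : ℝ, Tendsto (fun x : ℝ => V ((x : ℂ) + (y : ℂ) * Complex.I)) (𝓝[>] 0) (𝓝 (b y))

/-- The analytic function whose log-modulus is the Poisson integral of `log |b|`:
`exp { ∫ log |b(t)| [1/(z - it) - it/(1+t²)] dt/π }`. -/
def outerPart (b : ℝ → ℂ) (z : ℂ) : ℂ :=
  Complex.exp (∫ t : ℝ, ((Real.log ‖b t‖ / Real.pi : ℝ) : ℂ) *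
    (1 / (z - Complex.I * (t : ℂ)) - Complex.I * (t : ℂ) / (1 + (t : ℂ) ^ 2)))

/-- `V` is outer: it has boundary values a.e., these are a.e. non-zero with `log |V(iy)|`
integrable against `dy/(1+y²)`, and `|V|` equals the modulus of the outer part of `V` throughout
the right half-plane. -/
def IsOuter (V : ℂ → ℂ) : Prop :=
  DifferentiableOn ℂ V rightHalfPlane ∧
  ∃ b : ℝ → ℂ, IsBoundaryValue V b ∧ (∀ᵐ y : ℝ, b y ≠ 0) ∧
    Integrable (fun y : ℝ => Real.log ‖b y‖ / (1 + y ^ 2)) ∧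
    ∀ z ∈ rightHalfPlane, ‖V z‖ = ‖outerPart b z‖

end

/-!
On the right half-plane `V` has a closed form. At time `t` the superlevel set of the evolved
Gaussian is a ball, so `μ(e^{-k})` is an integral over `t` of powers of `(k - (d/2) log (1 + t²))₊`;
by Tonelli, a Gamma integral in `k` and a Beta integral in `t` give
`V(z) = (2π)^{d/2} (z + c)^{-(d/2 + 1)} B(d/2 (z + c - 1) - 1/2, 1/2)`
for real `z`, and analytic continuation extends this to `re z > 1 + 1/d - c`.

The real part of `B(u, 1/2) = ∑ₙ aₙ / (u + n)`, `aₙ ≥ 0`, is nonnegative for `re u > 0`, and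
`B(u, 1/2)` has no zeros there; hence the principal logarithms of the factors of `V` add up to an
analytic logarithm `f` of `V` on the closed half-plane. For `re u ≥ a > 0`, `B(u, 1/2)` is bounded,
so `B(u, 1/2) B(u + 1/2, 1/2) = π / u` bounds it below by a multiple of `1 / ‖u‖`. Thus `f` grows
only logarithmically, while `V = O(1 / ‖z‖)` puts `V` in `H²`.

Finally, Cauchy's theorem applied to `w ↦ (f w - f z) / ((w - z) (w + conj z))`, whose denominator
is a multiple of the reciprocal of the Poisson kernel on the imaginary axis, shows that a function
of sublinear growth is the Poisson integral of its boundary values; the real part of this identity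
for `f` is the outer factorization of `V = exp f`.
-/

open Complex Asymptotics Set Bornology
open scoped Real ComplexConjugate

/-! ### The Poisson formula in the right half-plane -/

lemma isOpen_rightHalfPlane : IsOpen rightHalfPlane := isOpen_lt continuous_const continuous_re

lemma closure_rightHalfPlane : closure rightHalfPlane = {z : ℂ | 0 ≤ z.re} :=
  closure_setOfPred_lt_re 0

lemma mem_closure_rightHalfPlane {z : ℂ} : z ∈ closure rightHalfPlane ↔ 0 ≤ z.re := by
  rw [closure_rightHalfPlane, mem_ofPred_eq]

lemma ofReal_mul_I_mem_closure_rightHalfPlane (t : ℝ) : t * I ∈ closure rightHalfPlane := by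
  simp [mem_closure_rightHalfPlane]

lemma continuous_comp_imaginary_axis {E : Type*} [TopologicalSpace E] {f : ℂ → E}
    (hf : ContinuousOn f (closure rightHalfPlane)) : Continuous fun t : ℝ => f (t * I) :=
  hf.comp_continuous (by fun_prop) ofReal_mul_I_mem_closure_rightHalfPlane

lemma norm_integral_imaginary_segment_le {h : ℂ → ℂ} (hh : DiffContOnCl ℂ h rightHalfPlane)
    {R C : ℝ} (hR : 0 < R) (hC : ∀ w ∈ closure rightHalfPlane, R ≤ ‖w‖ → ‖h w‖ ≤ C) :
    ‖∫ t in -R..R, h (t * I)‖ ≤ 4 * R * C := by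
  have hrect := integral_boundary_rect_eq_zero_of_continuousOn_of_differentiableOn h
    (-(R : ℂ) * I) (R + R * I)
    (hh.continuousOn.mono fun w hw => mem_closure_rightHalfPlane.2 (by
      have : w.re ∈ uIcc 0 R := by simpa using hw.1
      exact (uIcc_of_le hR.le ▸ this).1))
    (hh.differentiableOn.mono fun w hw => show 0 < w.re by simpa [hR.le] using hw.1.1)
  simp only [mul_re, mul_im, neg_re, neg_im, add_re, add_im, ofReal_re, ofReal_im, I_re, I_im,
    mul_zero, mul_one, neg_zero, sub_zero, add_zero, zero_add, ofReal_zero, smul_eq_mul] at hrect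
  have horizontal (s : ℝ) (hs : |s| = R) : ‖∫ x in (0 : ℝ)..R, h (x + s * I)‖ ≤ C * R := by
    refine (intervalIntegral.norm_integral_le_of_norm_le_const (C := C) fun x hx => ?_).trans
      (by rw [sub_zero, abs_of_pos hR])
    rw [uIoc_of_le hR.le] at hx
    refine hC _ (mem_closure_rightHalfPlane.2 (by simpa using hx.1.le)) ?_
    simpa [hs] using abs_im_le_norm (x + s * I)
  have vertical : ‖∫ y in -R..R, h (R + y * I)‖ ≤ C * (2 * R) := by
    refine (intervalIntegral.norm_integral_le_of_norm_le_const (C := C) fun y _ => ?_).trans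
      (by rw [sub_neg_eq_add, abs_of_pos (by positivity), two_mul])
    refine hC _ (mem_closure_rightHalfPlane.2 (by simpa using hR.le)) ?_
    simpa using re_le_norm (R + y * I)
  have hbottom := horizontal (-R) (by rw [abs_neg, abs_of_pos hR])
  have htop := horizontal R (abs_of_pos hR)
  calc ‖∫ t in -R..R, h (t * I)‖ = ‖I * ∫ t in -R..R, h (t * I)‖ := by simp
    _ = ‖(∫ x in (0 : ℝ)..R, h (x + (-R : ℝ) * I)) - (∫ x in (0 : ℝ)..R, h (x + R * I)) +
          I * ∫ y in -R..R, h (R + y * I)‖ := by rw [sub_eq_zero.1 hrect]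
    _ ≤ ‖∫ x in (0 : ℝ)..R, h (x + (-R : ℝ) * I)‖ + ‖∫ x in (0 : ℝ)..R, h (x + R * I)‖ +
          ‖∫ y in -R..R, h (R + y * I)‖ :=
        (norm_add_le _ _).trans (add_le_add (norm_sub_le _ _) (by simp))
    _ ≤ 4 * R * C := by linarith

lemma integral_imaginary_axis_eq_zero {h : ℂ → ℂ} (hh : DiffContOnCl ℂ h rightHalfPlane)
    (ho : h =o[cobounded ℂ ⊓ 𝓟 (closure rightHalfPlane)] fun w => w⁻¹)
    (hint : Integrable fun t : ℝ => h (t * I)) : ∫ t : ℝ, h (t * I) = 0 := by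
  have hlim := intervalIntegral_tendsto_integral hint tendsto_neg_atTop_atBot tendsto_id
  refine tendsto_nhds_unique hlim (isLittleO_one_iff ℝ |>.1 (isLittleO_iff.2 fun ε hε => ?_))
  have hfar := isLittleO_iff.1 ho (show 0 < ε / 4 by positivity)
  rw [eventually_inf_principal, hasBasis_cobounded_norm.eventually_iff] at hfar
  obtain ⟨R₀, -, hR₀⟩ := hfar
  filter_upwards [eventually_gt_atTop 0, eventually_ge_atTop R₀] with R hR hR₀R
  refine (norm_integral_imaginary_segment_le hh hR (C := ε / 4 * R⁻¹) fun w hw hRw =>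
    (hR₀ (hR₀R.trans hRw) hw).trans ?_).trans (le_of_eq ?_)
  · rw [norm_inv]
    gcongr
  · rw [norm_one]
    field_simp

/-- The kernel of the Herglotz representation in the right half-plane: its real part is `π` times
the Poisson kernel, and the term independent of `z` makes it decay like `(1 + t²)⁻¹`. -/
noncomputable def herglotzKernel (z : ℂ) (t : ℝ) : ℂ :=
  1 / (z - I * (t : ℂ)) - I * (t : ℂ) / (1 + (t : ℂ) ^ 2)

lemma re_le_norm_sub_I_mul (z : ℂ) (t : ℝ) : z.re ≤ ‖z - I * (t : ℂ)‖ := by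
  simpa using re_le_norm (z - I * (t : ℂ))

lemma sub_I_mul_ne_zero {z : ℂ} (hz : z ∈ rightHalfPlane) (t : ℝ) : z - I * (t : ℂ) ≠ 0 :=
  norm_pos_iff.1 (hz.trans_le (re_le_norm_sub_I_mul z t))

lemma norm_one_add_ofReal_sq (t : ℝ) : ‖1 + (t : ℂ) ^ 2‖ = 1 + t ^ 2 := by
  rw [← ofReal_one, ← ofReal_pow, ← ofReal_add, norm_real, Real.norm_of_nonneg (by positivity)]

lemma one_add_ofReal_sq_ne_zero (t : ℝ) : 1 + (t : ℂ) ^ 2 ≠ 0 := by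
  rw [← norm_pos_iff, norm_one_add_ofReal_sq]
  positivity

lemma continuous_herglotzKernel {z : ℂ} (hz : z ∈ rightHalfPlane) :
    Continuous (herglotzKernel z) := by
  have h₁ := sub_I_mul_ne_zero hz
  have h₂ := one_add_ofReal_sq_ne_zero
  unfold herglotzKernel
  fun_prop (disch := simp_all)

lemma norm_herglotzKernel_le {z : ℂ} (hz : z ∈ rightHalfPlane) (t : ℝ) :
    ‖herglotzKernel z t‖ ≤ (‖1 - z ^ 2‖ / z.re + ‖z‖) / (1 + t ^ 2) := by
  have common_denominator : herglotzKernel z t =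
      ((1 - z ^ 2) / (z - I * t) + z) / (1 + (t : ℂ) ^ 2) := by
    have h₁ := sub_I_mul_ne_zero hz t
    have h₂ := one_add_ofReal_sq_ne_zero t
    rw [herglotzKernel]
    field_simp
    linear_combination (t : ℂ) ^ 2 * I_sq
  have hre : 0 < z.re := hz
  rw [common_denominator, norm_div, norm_one_add_ofReal_sq]
  gcongr
  refine (norm_add_le _ _).trans ?_
  rw [norm_div]
  gcongr
  exact re_le_norm_sub_I_mul z t

lemma re_herglotzKernel (z : ℂ) (t : ℝ) :
    (herglotzKernel z t).re = z.re / (z.re ^ 2 + (t - z.im) ^ 2) := by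
  have h : I * (t : ℂ) / (1 + (t : ℂ) ^ 2) = ((t / (1 + t ^ 2) : ℝ) : ℂ) * I := by
    push_cast
    ring
  rw [herglotzKernel, h, sub_re, re_ofReal_mul, I_re, mul_zero, sub_zero, one_div, inv_re,
    normSq_apply]
  simp only [sub_re, mul_re, I_re, ofReal_re, I_im, ofReal_im, sub_im, mul_im]
  ring

lemma integral_re_herglotzKernel {z : ℂ} (hz : z ∈ rightHalfPlane) :
    ∫ t : ℝ, (herglotzKernel z t).re = π := by
  have hre : 0 < z.re := hz
  have h : ∫ t : ℝ, π⁻¹ * z.re * ((t - z.im) ^ 2 + z.re ^ 2)⁻¹ = 1 :=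
    ProbabilityTheory.integral_cauchyPDFReal_eq_one z.im (γ := ⟨z.re, hre.le⟩)
      (fun h₀ => hre.ne' (congrArg NNReal.toReal h₀))
  simp only [mul_assoc, integral_const_mul] at h
  rw [inv_mul_eq_one₀ Real.pi_ne_zero, ← integral_const_mul] at h
  simp_rw [h, re_herglotzKernel, div_eq_mul_inv, add_comm]

lemma integrable_mul_of_norm_le_div_one_add_sq {g k : ℝ → ℂ}
    (hg : Integrable fun t => g t / (1 + (t : ℂ) ^ 2)) (hk : Continuous k) {L : ℝ}
    (hkL : ∀ t, ‖k t‖ ≤ L / (1 + t ^ 2)) : Integrable fun t => g t * k t := by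
  have hbound (t : ℝ) : ‖(1 + (t : ℂ) ^ 2) * k t‖ ≤ L := by
    rw [norm_mul, norm_one_add_ofReal_sq, ← le_div_iff₀' (by positivity)]
    exact hkL t
  refine (hg.mul_bdd (c := L) (by fun_prop) (ae_of_all _ hbound)).congr (ae_of_all _ fun t => ?_)
  have := one_add_ofReal_sq_ne_zero t
  simp only
  field_simp

lemma isBigO_add_const_inv_cobounded (a : ℂ) :
    (fun w : ℂ => (w + a)⁻¹) =O[cobounded ℂ] fun w => w⁻¹ := by
  have h : (fun w : ℂ => w) =O[cobounded ℂ] fun w => w + a := by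
    simpa only [add_comm] using! (isLittleO_const_id_cobounded a).right_isBigO_add
  refine h.inv_rev ?_
  filter_upwards [eventually_ne_cobounded 0] with w hw hw'
  exact absurd hw' hw

lemma add_conj_ne_zero {z w : ℂ} (hz : z ∈ rightHalfPlane) (hw : w ∈ closure rightHalfPlane) :
    w + conj z ≠ 0 := by
  have hz : 0 < z.re := hz
  rw [mem_closure_rightHalfPlane] at hw
  intro h
  have := congrArg re h
  simp only [add_re, conj_re, zero_re] at this
  linarith

section PoissonFormula

variable {f : ℂ → ℂ} {z : ℂ}

lemma diffContOnCl_dslope_div_add_conj (hf : DiffContOnCl ℂ f rightHalfPlane)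
    (hz : z ∈ rightHalfPlane) :
    DiffContOnCl ℂ (fun w => dslope f z w / (w + conj z)) rightHalfPlane := by
  have hnhds := isOpen_rightHalfPlane.mem_nhds hz
  constructor
  · exact ((differentiableOn_dslope hnhds).2 hf.differentiableOn).div (by fun_prop)
      fun w hw => add_conj_ne_zero hz (subset_closure hw)
  · refine ContinuousOn.div ?_ (by fun_prop) fun w hw => add_conj_ne_zero hz hw
    exact (continuousOn_dslope (mem_of_superset hnhds subset_closure)).2
      ⟨hf.continuousOn, hf.differentiableAt isOpen_rightHalfPlane hz⟩

lemma isLittleO_dslope_div_add_conj {l : Filter ℂ} (hl : l ≤ cobounded ℂ)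
    (hf : f =o[l] (id : ℂ → ℂ)) (z : ℂ) :
    (fun w => dslope f z w / (w + conj z)) =o[l] fun w => w⁻¹ := by
  have hsub : (fun w => f w - f z) =o[l] fun w => w :=
    hf.sub ((isLittleO_const_id_cobounded _).mono hl)
  have hinv : (fun w => (w - z)⁻¹ * (w + conj z)⁻¹) =O[l] fun w => w⁻¹ * w⁻¹ :=
    (((isBigO_add_const_inv_cobounded (-z)).mul
      (isBigO_add_const_inv_cobounded (conj z))).mono hl)
  refine (hsub.mul_isBigO hinv).congr' ?_ ?_
  · filter_upwards [hl (eventually_ne_cobounded z)] with w hw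
    rw [dslope_of_ne _ hw, slope_def_field]
    ring
  · filter_upwards [hl (eventually_ne_cobounded 0)] with w hw
    field_simp

lemma dslope_div_add_conj_ofReal_mul_I (f : ℂ → ℂ) (hz : z ∈ rightHalfPlane) (t : ℝ) :
    dslope f z (t * I) / (t * I + conj z) = -(z.re : ℂ)⁻¹ *
      (f (t * I) * (herglotzKernel z t).re - f z * (herglotzKernel z t).re) := by
  have hre : 0 < z.re := hz
  have hne : t * I ≠ z := fun h => hre.ne (by simpa using congrArg re h)
  have hprod : (t * I - z) * (t * I + conj z) = -((z.re ^ 2 + (t - z.im) ^ 2 : ℝ) : ℂ) := by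
    rw [← ofReal_neg]
    apply Complex.ext
    · simp only [mul_re, sub_re, sub_im, add_re, add_im, mul_im, conj_re, conj_im, ofReal_re,
        ofReal_im, I_re, I_im]
      ring
    · simp only [mul_re, mul_im, sub_re, sub_im, add_re, add_im, conj_re, conj_im, ofReal_re,
        ofReal_im, I_re, I_im]
      ring
  have hpos : ((z.re ^ 2 + (t - z.im) ^ 2 : ℝ) : ℂ) ≠ 0 :=
    ofReal_ne_zero.2 (by positivity)
  have hre' : (z.re : ℂ) ≠ 0 := ofReal_ne_zero.2 hre.ne'
  rw [dslope_of_ne _ hne, slope_def_field, div_div, hprod, re_herglotzKernel, ofReal_div]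
  field_simp

lemma integrable_mul_re_herglotzKernel {g : ℝ → ℂ}
    (hg : Integrable fun t : ℝ => g t / (1 + (t : ℂ) ^ 2)) (hz : z ∈ rightHalfPlane) :
    Integrable fun t : ℝ => g t * (herglotzKernel z t).re :=
  integrable_mul_of_norm_le_div_one_add_sq hg
    (continuous_ofReal.comp (continuous_re.comp (continuous_herglotzKernel hz)))
    fun t => (norm_real _).trans_le <| (abs_re_le_norm _).trans (norm_herglotzKernel_le hz t)

theorem integral_mul_re_herglotzKernel (hf : DiffContOnCl ℂ f rightHalfPlane)
    (ho : f =o[cobounded ℂ ⊓ 𝓟 (closure rightHalfPlane)] (id : ℂ → ℂ))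
    (hint : Integrable fun t : ℝ => f (t * I) / (1 + (t : ℂ) ^ 2)) (hz : z ∈ rightHalfPlane) :
    ∫ t : ℝ, f (t * I) * (herglotzKernel z t).re = π * f z := by
  have hint_f := integrable_mul_re_herglotzKernel hint hz
  have hint_const : Integrable fun t : ℝ => f z * ((herglotzKernel z t).re : ℂ) := by
    refine integrable_mul_re_herglotzKernel (g := fun _ => f z) ?_ hz
    have := (integrable_inv_one_add_sq.ofReal (𝕜 := ℂ)).const_mul (f z)
    simpa [div_eq_mul_inv] using this
  have hzero := integral_imaginary_axis_eq_zero (diffContOnCl_dslope_div_add_conj hf hz)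
    (isLittleO_dslope_div_add_conj inf_le_left ho z) (by
      simp_rw [dslope_div_add_conj_ofReal_mul_I f hz]
      exact (hint_f.sub hint_const).const_mul _)
  simp_rw [dslope_div_add_conj_ofReal_mul_I f hz] at hzero
  have hre : -(z.re : ℂ)⁻¹ ≠ 0 := by
    simpa using (show 0 < z.re from hz).ne'
  rw [integral_const_mul, integral_sub hint_f hint_const, mul_eq_zero, sub_eq_zero] at hzero
  rw [hzero.resolve_left hre, integral_const_mul, integral_complex_ofReal,
    integral_re_herglotzKernel hz, mul_comm]

end PoissonFormula

lemma isBoundaryValue_of_eqOn {V g : ℂ → ℂ} (hV : EqOn V g rightHalfPlane)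
    (hg : ContinuousOn g (closure rightHalfPlane)) : IsBoundaryValue V fun y => g (y * I) := by
  refine ae_of_all _ fun y => ?_
  have hmem : ∀ᶠ x : ℝ in 𝓝[>] 0, x + y * I ∈ rightHalfPlane := by
    filter_upwards [self_mem_nhdsWithin] with x hx
    exact show 0 < (x + y * I).re by simpa using hx
  have hline : Tendsto (fun x : ℝ => x + y * I) (𝓝[>] 0)
      (𝓝[closure rightHalfPlane] (y * I)) := by
    refine tendsto_nhdsWithin_iff.2
      ⟨tendsto_nhdsWithin_of_tendsto_nhds ?_, hmem.mono fun _ hx => subset_closure hx⟩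
    exact Continuous.tendsto' (by fun_prop) 0 _ (by simp)
  refine ((hg _ (ofReal_mul_I_mem_closure_rightHalfPlane y)).tendsto.comp hline).congr' ?_
  exact hmem.mono fun x hx => (hV hx).symm

lemma integrable_re_div_one_add_sq {g : ℝ → ℂ}
    (hg : Integrable fun t : ℝ => g t / (1 + (t : ℂ) ^ 2)) :
    Integrable fun t : ℝ => (g t).re / (1 + t ^ 2) := by
  have hre (t : ℝ) : (g t / (1 + (t : ℂ) ^ 2)).re = (g t).re / (1 + t ^ 2) := by
    rw [← ofReal_one, ← ofReal_pow, ← ofReal_add, div_ofReal_re]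
  exact hg.re.congr (ae_of_all _ hre)

lemma re_integral_re_mul_herglotzKernel {f : ℂ → ℂ} {z : ℂ}
    (hf : DiffContOnCl ℂ f rightHalfPlane)
    (ho : f =o[cobounded ℂ ⊓ 𝓟 (closure rightHalfPlane)] (id : ℂ → ℂ))
    (hint : Integrable fun t : ℝ => f (t * I) / (1 + (t : ℂ) ^ 2)) (hz : z ∈ rightHalfPlane) :
    (∫ t : ℝ, ((f (t * I)).re / π : ℝ) * herglotzKernel z t).re = (f z).re := by
  have hint_re : Integrable fun t : ℝ => ((f (t * I)).re / π : ℝ) * herglotzKernel z t := by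
    refine integrable_mul_of_norm_le_div_one_add_sq ?_ (continuous_herglotzKernel hz)
      (norm_herglotzKernel_le hz)
    refine ((integrable_re_div_one_add_sq hint).div_const π).ofReal.congr (ae_of_all _ fun t => ?_)
    change (((f (t * I)).re / (1 + t ^ 2) / π : ℝ) : ℂ) = _
    push_cast
    ring
  have hPoisson := congrArg re (integral_mul_re_herglotzKernel hf ho hint hz)
  rw [re_ofReal_mul, ← reCLM_apply,
    ← reCLM.integral_comp_comm (integrable_mul_re_herglotzKernel hint hz)] at hPoisson
  rw [← reCLM_apply, ← reCLM.integral_comp_comm hint_re, ← mul_right_inj' Real.pi_ne_zero,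
    ← hPoisson, ← integral_const_mul]
  congr with t
  rw [reCLM_apply, reCLM_apply, re_ofReal_mul, re_mul_ofReal]
  field_simp

theorem isOuter_of_eqOn_exp {V f : ℂ → ℂ} (hV : EqOn V (fun z => cexp (f z)) rightHalfPlane)
    (hf : DiffContOnCl ℂ f rightHalfPlane)
    (ho : f =o[cobounded ℂ ⊓ 𝓟 (closure rightHalfPlane)] (id : ℂ → ℂ))
    (hint : Integrable fun t : ℝ => f (t * I) / (1 + (t : ℂ) ^ 2)) : IsOuter V := by
  have hlog (t : ℝ) : Real.log ‖cexp (f (t * I))‖ = (f (t * I)).re := by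
    rw [norm_exp, Real.log_exp]
  refine ⟨hf.differentiableOn.cexp.congr hV, fun t => cexp (f (t * I)),
    isBoundaryValue_of_eqOn hV hf.continuousOn.cexp, ae_of_all _ fun y => exp_ne_zero _, ?_,
    fun z hz => ?_⟩
  · simpa only [hlog] using integrable_re_div_one_add_sq hint
  · simp_rw [outerPart, hlog]
    rw [hV hz, norm_exp, norm_exp, ← re_integral_re_mul_herglotzKernel hf ho hint hz]
    rfl

section SublinearGrowth

variable {f : ℂ → ℂ} {s : Set ℂ} {α : ℝ} (hα : α < 1)
  (hf : f =O[𝓟 s] fun z => (1 + ‖z‖) ^ α)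
include hα hf

lemma isLittleO_id_of_isBigO_rpow : f =o[cobounded ℂ ⊓ 𝓟 s] (id : ℂ → ℂ) := by
  have hnorm : Tendsto (fun z : ℂ => 1 + ‖z‖) (cobounded ℂ) atTop :=
    tendsto_atTop_add_const_left _ _ tendsto_norm_cobounded_atTop
  have hpow : (fun x : ℝ => x ^ α) =o[atTop] fun x => x := by
    refine isLittleO_of_tendsto' ((eventually_ne_atTop 0).mono fun x hx h => absurd h hx)
      ((tendsto_rpow_neg_atTop (sub_pos.2 hα)).congr' ?_)
    filter_upwards [eventually_gt_atTop 0] with x hx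
    rw [neg_sub, Real.rpow_sub hx, Real.rpow_one]
  have hlin : (fun z : ℂ => 1 + ‖z‖) =O[cobounded ℂ] (id : ℂ → ℂ) := by
    refine IsBigO.of_bound 2 ?_
    filter_upwards [tendsto_norm_cobounded_atTop.eventually_ge_atTop 1] with z hz
    rw [Real.norm_of_nonneg (by positivity), id]
    linarith
  exact (hf.mono inf_le_right).trans_isLittleO
    (((hpow.comp_tendsto hnorm).trans_isBigO hlin).mono inf_le_left)

lemma integrable_div_one_add_sq_of_isBigO_rpow (hc : Continuous fun t : ℝ => f (t * I))
    (hs : ∀ t : ℝ, t * I ∈ s) : Integrable fun t : ℝ => f (t * I) / (1 + (t : ℂ) ^ 2) := by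
  obtain ⟨C, hC⟩ := isBigO_principal.1 hf
  have hmajorant : Integrable fun t : ℝ => 2 * C * (1 + ‖t‖) ^ (-(2 - α)) :=
    (integrable_one_add_norm (by norm_num; linarith)).const_mul _
  refine hmajorant.mono' (hc.div₀ (by fun_prop) one_add_ofReal_sq_ne_zero).aestronglyMeasurable
    (ae_of_all _ fun t => ?_)
  have hpos : 0 < 1 + |t| := by positivity
  have hft : ‖f (t * I)‖ ≤ C * (1 + |t|) ^ α := by
    simpa [Real.norm_of_nonneg (Real.rpow_nonneg hpos.le α)] using hC _ (hs t)
  have hC₀ : 0 ≤ C * (1 + |t|) ^ α := (norm_nonneg _).trans hft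
  rw [norm_div, norm_one_add_ofReal_sq, div_le_iff₀ (by positivity)]
  calc ‖f (t * I)‖ ≤ C * (1 + |t|) ^ α := hft
    _ = C * (1 + |t|) ^ α * ((1 + |t|) ^ (-2 : ℝ) * (1 + |t|) ^ 2) := by
      rw [← Real.rpow_natCast (1 + |t|) 2, ← Real.rpow_add hpos]
      simp
    _ ≤ C * (1 + |t|) ^ α * ((1 + |t|) ^ (-2 : ℝ) * (2 * (1 + t ^ 2))) := by
      gcongr
      nlinarith [sq_nonneg (1 - |t|), sq_abs t]
    _ = 2 * C * (1 + ‖t‖) ^ (-(2 - α)) * (1 + t ^ 2) := by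
      rw [Real.norm_eq_abs, neg_sub, sub_eq_add_neg, Real.rpow_add hpos]
      ring

end SublinearGrowth

lemma memHardyTwo_of_isBigO {V : ℂ → ℂ} (hV : DifferentiableOn ℂ V rightHalfPlane)
    (hO : V =O[𝓟 rightHalfPlane] fun z => (1 + ‖z‖)⁻¹) : MemHardyTwo V := by
  obtain ⟨C, hC⟩ := isBigO_principal.1 hO
  have hint : Integrable fun y : ℝ => C ^ 2 * (1 + y ^ 2)⁻¹ :=
    integrable_inv_one_add_sq.const_mul _
  refine ⟨hV, lt_of_le_of_lt (iSup₂_le fun x hx => ?_) hint.lintegral_lt_top⟩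
  refine lintegral_mono fun y => ?_
  have hnorm : ‖V (x + y * I)‖ ^ 2 ≤ C ^ 2 * (1 + y ^ 2)⁻¹ := by
    have hC := hC (x + y * I) (show 0 < (x + y * I).re by simpa using hx)
    have hy : |y| ≤ ‖x + y * I‖ := by simpa using abs_im_le_norm (x + y * I)
    calc ‖V (x + y * I)‖ ^ 2 ≤ (C * ‖(1 + ‖x + y * I‖)⁻¹‖) ^ 2 := by gcongr
      _ = C ^ 2 * ((1 + ‖x + y * I‖) ^ 2)⁻¹ := by rw [mul_pow, Real.norm_eq_abs, sq_abs, inv_pow]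
      _ ≤ C ^ 2 * (1 + y ^ 2)⁻¹ := by
        gcongr
        nlinarith [abs_nonneg y, sq_abs y]
  rw [← ofReal_norm, ← ENNReal.ofReal_pow (norm_nonneg _)]
  exact ENNReal.ofReal_le_ofReal hnorm

lemma isBigO_const_of_one_le {ι E : Type*} [SeminormedAddCommGroup E] {l : Filter ι} {r : ι → ℝ}
    (hr : ∀ i, 1 ≤ r i) (w : E) :
    (fun _ => w) =O[l] r :=
  isBigO_of_le' (c := ‖w‖) _ fun i =>
    le_mul_of_one_le_right (norm_nonneg w) ((hr i).trans (Real.le_norm_self _))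

lemma abs_log_le_rpow_add_rpow_div {x α : ℝ} (hx : 0 ≤ x) (hα : 0 < α) :
    |Real.log x| ≤ (x ^ α + x⁻¹ ^ α) / α := by
  have hlog := Real.log_le_rpow_div hx hα
  have hlog_inv := Real.log_le_rpow_div (inv_nonneg.2 hx) hα
  have hpos : 0 ≤ x ^ α / α := by positivity
  have hpos_inv : 0 ≤ x⁻¹ ^ α / α := by positivity
  rw [Real.log_inv] at hlog_inv
  rw [add_div, abs_le]
  constructor <;> linarith

lemma isBigO_log_of_isBigO_of_isBigO_inv {ι : Type*} {l : Filter ι} {g : ι → ℂ} {r : ι → ℝ}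
    {α : ℝ} (hα : 0 < α) (hr : ∀ i, 1 ≤ r i) (hg : g =O[l] r)
    (hg_inv : (fun i => (g i)⁻¹) =O[l] r) :
    (fun i => log (g i)) =O[l] fun i => r i ^ α := by
  have hr₀ : 0 ≤ᶠ[l] r := Eventually.of_forall fun i => zero_le_one.trans (hr i)
  have hπ := isBigO_const_of_one_le (l := l) (fun i => Real.one_le_rpow (hr i) hα.le) π
  have hpow := ((hg.norm_left.rpow hα.le hr₀).add
    (hg_inv.norm_left.rpow hα.le hr₀)).const_mul_left α⁻¹
  refine (IsBigO.of_norm_le fun i => ?_).trans (hpow.add hπ)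
  calc ‖log (g i)‖ ≤ |(log (g i)).re| + |(log (g i)).im| := norm_le_abs_re_add_abs_im _
    _ ≤ α⁻¹ * (‖g i‖ ^ α + ‖(g i)⁻¹‖ ^ α) + π := by
      rw [log_re, log_im, norm_inv, inv_mul_eq_div]
      exact add_le_add (abs_log_le_rpow_add_rpow_div (norm_nonneg _) hα) (abs_arg_le_pi _)

/-! ### The Beta function in its first argument -/

section Beta

variable {u v w : ℂ}

lemma betaIntegral_ne_zero (hu : 0 < u.re) (hv : 0 < v.re) : betaIntegral u v ≠ 0 := by
  rw [betaIntegral_eq_Gamma_mul_div u v hu hv]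
  exact div_ne_zero (mul_ne_zero (Gamma_ne_zero_of_re_pos hu) (Gamma_ne_zero_of_re_pos hv))
    (Gamma_ne_zero_of_re_pos (add_pos hu hv))

lemma betaIntegral_mul_betaIntegral_add (hu : 0 < u.re) (hv : 0 < v.re) (hw : 0 < w.re) :
    betaIntegral u v * betaIntegral (u + v) w = betaIntegral v w * betaIntegral u (v + w) := by
  have huv : 0 < (u + v).re := add_pos hu hv
  have hvw : 0 < (v + w).re := add_pos hv hw
  rw [betaIntegral_eq_Gamma_mul_div u v hu hv, betaIntegral_eq_Gamma_mul_div _ w huv hw,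
    betaIntegral_eq_Gamma_mul_div v w hv hw, betaIntegral_eq_Gamma_mul_div u _ hu hvw, add_assoc]
  have := Gamma_ne_zero_of_re_pos huv
  have := Gamma_ne_zero_of_re_pos hvw
  field_simp

lemma differentiableAt_betaIntegral_left (hu : 0 < u.re) (hv : 0 < v.re) :
    DifferentiableAt ℂ (fun s => betaIntegral s v) u := by
  have hGamma {s : ℂ} (hs : 0 < s.re) : DifferentiableAt ℂ Gamma s :=
    differentiableAt_Gamma s fun m h => by simp [h] at hs; linarith [m.cast_nonneg (α := ℝ)]
  have huv : 0 < (u + v).re := add_pos hu hv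
  have heq : (fun s => betaIntegral s v) =ᶠ[𝓝 u] fun s => Gamma s * Gamma v / Gamma (s + v) := by
    filter_upwards [isOpen_rightHalfPlane.mem_nhds hu] with s hs
    exact betaIntegral_eq_Gamma_mul_div s v hs hv
  refine DifferentiableAt.congr_of_eventuallyEq ?_ heq
  exact ((hGamma hu).mul_const _).div ((hGamma huv).comp u (f := fun s => s + v) (by fun_prop))
    (Gamma_ne_zero_of_re_pos huv)

lemma norm_betaIntegral_le {a : ℝ} (ha : 0 < a) (hau : a ≤ u.re) (hv : 0 < v.re) :
    ‖betaIntegral u v‖ ≤ ∫ x in (0 : ℝ)..1, ‖(x : ℂ) ^ ((a : ℂ) - 1) * (1 - x : ℂ) ^ (v - 1)‖ := by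
  refine intervalIntegral.norm_integral_le_of_norm_le zero_le_one ?_
    (betaIntegral_convergent (by simpa using ha) hv).norm
  refine ae_of_all _ fun x hx => ?_
  rw [norm_mul, norm_mul, norm_cpow_eq_rpow_re_of_pos hx.1, norm_cpow_eq_rpow_re_of_pos hx.1]
  gcongr ?_ * _
  exact Real.rpow_le_rpow_of_exponent_ge hx.1 hx.2 (by simpa using hau)

lemma isBigO_one_betaIntegral_left {a : ℝ} (ha : 0 < a) (hv : 0 < v.re) :
    (fun u => betaIntegral u v) =O[𝓟 {u | a ≤ u.re}] fun _ => (1 : ℂ) :=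
  isBigO_principal.2 ⟨_, fun _ hu => by simpa using norm_betaIntegral_le ha hu hv⟩

lemma isBigO_inv_betaIntegral_left {a : ℝ} (ha : 0 < a) (hv : 0 < v.re) (hv₁ : v.re < 1) :
    (fun u => (betaIntegral u v)⁻¹) =O[𝓟 {u | a ≤ u.re}] fun u => u := by
  have hv' : 0 < (1 - v).re := by simpa using hv₁
  have hC := betaIntegral_ne_zero hv hv'
  have hinv : EqOn (fun u => (betaIntegral v (1 - v))⁻¹ * (u * betaIntegral (u + v) (1 - v)))
      (fun u => (betaIntegral u v)⁻¹) {u | a ≤ u.re} := fun u hu => by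
    have hu : 0 < u.re := ha.trans_le hu
    have hmul := betaIntegral_mul_betaIntegral_add hu hv hv'
    have hu₀ : u ≠ 0 := ne_zero_of_re_pos hu
    have hB := betaIntegral_ne_zero hu hv
    rw [add_sub_cancel, betaIntegral_eval_one_right hu, mul_one_div, eq_div_iff hu₀] at hmul
    simp only
    field_simp
    linear_combination hmul
  have hshift : (fun u => betaIntegral (u + v) (1 - v)) =O[𝓟 {u | a ≤ u.re}] fun _ => (1 : ℂ) :=
    (isBigO_one_betaIntegral_left ha hv').comp_tendsto
      (tendsto_principal_principal.2 fun u hu => show a ≤ (u + v).re from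
        (show a ≤ u.re from hu).trans (by simpa using hv.le))
  simpa using (((isBigO_refl (fun u : ℂ => u) _).mul hshift).const_mul_left _).congr'
    (eventually_principal.2 hinv) .rfl

lemma choose_add_sub_one_nonneg {a : ℝ} (ha : 0 < a) (n : ℕ) : 0 ≤ Ring.choose (a + n - 1) n := by
  have hasc := Ring.factorial_nsmul_multichoose_eq_ascPochhammer a n
  rw [Polynomial.ascPochhammer_smeval_eq_eval, nsmul_eq_mul] at hasc
  have hchoose : Ring.choose (a + n - 1) n = Ring.multichoose a n := by
    rw [Ring.choose]
    congr 1
    ring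
  rw [hchoose]
  exact (pos_of_mul_pos_right (hasc ▸ ascPochhammer_pos n a ha) (by positivity)).le

lemma hasSum_choose_mul_pow_one_sub_rpow (a : ℝ) {x : ℝ} (hx : |x| < 1) :
    HasSum (fun n : ℕ => Ring.choose (a + n - 1) n * x ^ n) ((1 - x) ^ (-a)) := by
  have h := (Real.one_div_one_sub_rpow_hasFPowerSeriesOnBall_zero a).hasSum (y := x)
    (by simpa [enorm_eq_nnnorm, ← NNReal.coe_lt_one] using hx)
  simp only [zero_add, FormalMultilinearSeries.ofScalars_apply_eq, smul_eq_mul] at h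
  rwa [Real.rpow_neg (by linarith [le_abs_self x]), ← one_div]

lemma integral_const_mul_cpow_unit_interval (a : ℂ) (hu : 0 < u.re) :
    ∫ x in (0 : ℝ)..1, a * (x : ℂ) ^ (u - 1) = a / u := by
  rw [intervalIntegral.integral_const_mul, div_eq_mul_one_div,
    ← betaIntegral_eval_one_right hu]
  simp [betaIntegral]

section UnitInterval

variable {v x : ℝ} (hv₁ : v < 1) (hx : x ∈ Ioo (0 : ℝ) 1)
include hv₁ hx

lemma hasSum_betaIntegral_integrand (u : ℂ) :
    HasSum (fun n : ℕ => ((Ring.choose (1 - v + n - 1) n : ℝ) : ℂ) * (x : ℂ) ^ (u + n - 1))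
      ((x : ℂ) ^ (u - 1) * (1 - x : ℂ) ^ ((v : ℂ) - 1)) ∧
    HasSum (fun n : ℕ => ‖((Ring.choose (1 - v + n - 1) n : ℝ) : ℂ) * (x : ℂ) ^ (u + n - 1)‖)
      ‖(x : ℂ) ^ (u - 1) * (1 - x : ℂ) ^ ((v : ℂ) - 1)‖ := by
  have hterm (n : ℕ) : ((Ring.choose (1 - v + n - 1) n : ℝ) : ℂ) * (x : ℂ) ^ (u + n - 1) =
      (x : ℂ) ^ (u - 1) * (Ring.choose (1 - v + n - 1) n * x ^ n : ℝ) := by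
    rw [add_sub_right_comm u, cpow_add _ _ (ofReal_ne_zero.2 hx.1.ne'), cpow_natCast]
    push_cast
    ring
  have hlimit : (1 - x : ℂ) ^ ((v : ℂ) - 1) = ((1 - x) ^ (v - 1) : ℝ) := by
    rw [ofReal_cpow (by linarith [hx.2])]
    push_cast
    rfl
  have hterm_nonneg (n : ℕ) : 0 ≤ Ring.choose (1 - v + n - 1) n * x ^ n :=
    mul_nonneg (choose_add_sub_one_nonneg (sub_pos.2 hv₁) n) (pow_nonneg hx.1.le n)
  have hseries : HasSum (fun n : ℕ => Ring.choose (1 - v + n - 1) n * x ^ n)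
      ((1 - x) ^ (v - 1)) := by
    simpa using hasSum_choose_mul_pow_one_sub_rpow (1 - v) (abs_lt.2 ⟨by linarith [hx.1], hx.2⟩)
  simp_rw [hterm, hlimit, norm_mul, norm_real, Real.norm_of_nonneg (hterm_nonneg _),
    Real.norm_of_nonneg (Real.rpow_nonneg (sub_nonneg.2 hx.2.le) _)]
  exact ⟨(hasSum_ofReal.2 hseries).mul_left _, hseries.mul_left _⟩

end UnitInterval

lemma hasSum_betaIntegral {v : ℝ} (hu : 0 < u.re) (hv : 0 < v) (hv₁ : v < 1) :
    HasSum (fun n : ℕ => ((Ring.choose (1 - v + n - 1) n : ℝ) : ℂ) / (u + n))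
      (betaIntegral u v) := by
  have hIoo : ∀ᵐ x : ℝ, x ∈ uIoc (0 : ℝ) 1 → x ∈ Ioo (0 : ℝ) 1 := by
    filter_upwards [compl_mem_ae_iff.2 (measure_singleton (1 : ℝ))] with x hx₁ hx
    rw [uIoc_of_le zero_le_one] at hx
    exact ⟨hx.1, lt_of_le_of_ne hx.2 hx₁⟩
  have hterm (n : ℕ) : ∫ x in (0 : ℝ)..1,
      ((Ring.choose (1 - v + n - 1) n : ℝ) : ℂ) * (x : ℂ) ^ (u + n - 1) =
        ((Ring.choose (1 - v + n - 1) n : ℝ) : ℂ) / (u + n) :=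
    integral_const_mul_cpow_unit_interval _ (by simpa using by positivity)
  simp_rw [← hterm]
  refine intervalIntegral.hasSum_integral_of_dominated_convergence
    (fun n x => ‖((Ring.choose (1 - v + n - 1) n : ℝ) : ℂ) * (x : ℂ) ^ (u + n - 1)‖)
    (fun n => Measurable.aestronglyMeasurable (by fun_prop))
    (fun n => ae_of_all _ fun x _ => le_rfl) ?_ ?_ ?_
  · filter_upwards [hIoo] with x hx hx'
    exact (hasSum_betaIntegral_integrand hv₁ (hx hx') u).2.summable
  · refine (betaIntegral_convergent hu (v := v) (by simpa using hv)).norm.congr_ae ?_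
    rw [EventuallyEq, ae_restrict_iff' measurableSet_uIoc]
    filter_upwards [hIoo] with x hx hx'
    exact (hasSum_betaIntegral_integrand hv₁ (hx hx') u).2.tsum_eq.symm
  · filter_upwards [hIoo] with x hx hx'
    exact (hasSum_betaIntegral_integrand hv₁ (hx hx') u).1

lemma betaIntegral_mem_slitPlane {v : ℝ} (hu : 0 < u.re) (hv : 0 < v) (hv₁ : v < 1) :
    betaIntegral u v ∈ slitPlane := by
  have hre : 0 ≤ (betaIntegral u v).re := by
    refine (reCLM.hasSum (hasSum_betaIntegral hu hv hv₁)).nonneg fun n => ?_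
    have hun : 0 < (u + n).re := by simpa using by positivity
    rw [reCLM_apply, div_eq_mul_inv, re_ofReal_mul, inv_re]
    exact mul_nonneg (choose_add_sub_one_nonneg (sub_pos.2 hv₁) n)
      (div_nonneg hun.le (normSq_nonneg _))
  rw [mem_slitPlane_iff]
  by_contra! h
  exact betaIntegral_ne_zero hu (by simpa using hv) (Complex.ext (le_antisymm h.1 hre) h.2)

end Beta

lemma integrable_one_add_sq_rpow_neg {β : ℝ} (hβ : 1 / 2 < β) :
    Integrable fun t : ℝ => (1 + t ^ 2) ^ (-β) := by
  have h := integrable_rpow_neg_one_add_norm_sq (E := ℝ) (μ := volume) (r := 2 * β)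
    (by simp; linarith)
  simpa only [Real.norm_eq_abs, sq_abs, neg_div, mul_div_cancel_left₀ β two_ne_zero] using h

lemma image_inv_one_add_sq_Ioi : (fun t : ℝ => (1 + t ^ 2)⁻¹) '' Ioi 0 = Ioo 0 1 := by
  ext u
  constructor
  · rintro ⟨t, ht, rfl⟩
    have : 0 < t ^ 2 := pow_pos ht 2
    exact ⟨by positivity, inv_lt_one_of_one_lt₀ (by linarith)⟩
  · rintro ⟨hu₀, hu₁⟩
    have hu : 0 < u⁻¹ - 1 := sub_pos.2 (one_lt_inv_iff₀.2 ⟨hu₀, hu₁⟩)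
    exact ⟨√(u⁻¹ - 1), Real.sqrt_pos.2 hu, by simp [Real.sq_sqrt hu.le]⟩

lemma integral_unit_interval_eq_integral_inv_one_add_sq (f : ℝ → ℂ) :
    ∫ u in (0 : ℝ)..1, f u =
      ∫ t in Ioi (0 : ℝ), (2 * t / (1 + t ^ 2) ^ 2) • f (1 + t ^ 2)⁻¹ := by
  have hderiv : ∀ t ∈ Ioi (0 : ℝ), HasDerivWithinAt (fun t : ℝ => (1 + t ^ 2)⁻¹)
      (-(2 * t) / (1 + t ^ 2) ^ 2) (Ioi 0) t := fun t _ => by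
    have h : HasDerivAt (fun t : ℝ => 1 + t ^ 2) (2 * t) t := by
      simpa using (hasDerivAt_pow 2 t).const_add 1
    exact (h.inv (by positivity)).hasDerivWithinAt
  have hinj : InjOn (fun t : ℝ => (1 + t ^ 2)⁻¹) (Ioi 0) := fun s hs t ht hst =>
    (pow_left_inj₀ (le_of_lt hs) (le_of_lt ht) two_ne_zero).1
      (by linarith [inv_injective hst])
  rw [intervalIntegral.integral_of_le zero_le_one, integral_Ioc_eq_integral_Ioo,
    ← image_inv_one_add_sq_Ioi,
    integral_image_eq_integral_abs_deriv_smul measurableSet_Ioi hderiv hinj]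
  refine setIntegral_congr_fun measurableSet_Ioi fun t ht => ?_
  have ht : 0 < t := ht
  rw [neg_div, abs_neg, abs_of_pos (by positivity)]

lemma mul_inv_one_add_sq_rpow_mul_rpow (β : ℝ) {t : ℝ} (ht : 0 < t) :
    2 * t / (1 + t ^ 2) ^ 2 *
      ((1 + t ^ 2)⁻¹ ^ (β - 1 / 2 - 1) * (1 - (1 + t ^ 2)⁻¹) ^ (1 / 2 - 1 : ℝ)) =
    2 * (1 + t ^ 2) ^ (-β) := by
  have hp : 0 < 1 + t ^ 2 := by positivity
  have hone_sub : 1 - (1 + t ^ 2)⁻¹ = t ^ 2 / (1 + t ^ 2) := by field_simp; ring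
  have ht_pow : (t ^ 2) ^ (1 / 2 - 1 : ℝ) = t⁻¹ := by
    rw [← Real.rpow_natCast t 2, ← Real.rpow_mul ht.le, ← Real.rpow_neg_one]
    norm_num
  have hsplit : (1 + t ^ 2) ^ (-β) = (1 + t ^ 2) ^ (-(β - 1 / 2 - 1)) /
      ((1 + t ^ 2) ^ (1 / 2 - 1 : ℝ) * (1 + t ^ 2) ^ 2) := by
    rw [← Real.rpow_natCast (1 + t ^ 2) 2, ← Real.rpow_add hp, ← Real.rpow_sub hp]
    congr 1
    norm_num
    ring
  rw [hone_sub, Real.div_rpow (by positivity) hp.le, Real.inv_rpow hp.le, ← Real.rpow_neg hp.le,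
    ht_pow, hsplit]
  field_simp

lemma integral_one_add_sq_rpow_neg (β : ℝ) :
    ((∫ t : ℝ, (1 + t ^ 2) ^ (-β) : ℝ) : ℂ) = betaIntegral (β - 1 / 2) (1 / 2) := by
  have habs : ∫ t : ℝ, (1 + t ^ 2) ^ (-β) = ∫ t in Ioi (0 : ℝ), 2 * (1 + t ^ 2) ^ (-β) := by
    rw [integral_const_mul, ← integral_comp_abs (f := fun t : ℝ => (1 + t ^ 2) ^ (-β))]
    simp only [sq_abs]
  rw [habs, betaIntegral, integral_unit_interval_eq_integral_inv_one_add_sq,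
    ← integral_complex_ofReal]
  refine setIntegral_congr_fun measurableSet_Ioi fun t ht => ?_
  have hinv : (1 + t ^ 2)⁻¹ ≤ 1 := inv_le_one_of_one_le₀ (by nlinarith)
  rw [← mul_inv_one_add_sq_rpow_mul_rpow β ht, real_smul, ofReal_mul, ofReal_mul,
    ofReal_cpow (by positivity), ofReal_cpow (by linarith)]
  push_cast
  rfl

lemma isTheta_add_ofReal {a : ℝ} (ha : 0 < a) :
    (fun z : ℂ => z + a) =Θ[𝓟 (closure rightHalfPlane)] fun z => 1 + ‖z‖ := by
  have hnorm (z : ℂ) : ‖1 + ‖z‖‖ = 1 + ‖z‖ := Real.norm_of_nonneg (by positivity)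
  refine ⟨isBigO_principal.2 ⟨1 + a, fun z _ => ?_⟩,
    isBigO_principal.2 ⟨a⁻¹ + 2, fun z hz => ?_⟩⟩
  · rw [hnorm]
    calc ‖z + a‖ ≤ ‖z‖ + a := by simpa [abs_of_pos ha] using norm_add_le z a
      _ ≤ (1 + a) * (1 + ‖z‖) := by nlinarith [norm_nonneg z]
  · rw [mem_closure_rightHalfPlane] at hz
    have hle : a ≤ ‖z + a‖ := le_trans (by simpa using hz) (re_le_norm (z + a))
    have hsub : ‖z‖ ≤ ‖z + a‖ + a := by
      simpa [abs_of_pos ha] using norm_sub_le (z + a) (a : ℂ)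
    have hone : 1 ≤ a⁻¹ * ‖z + a‖ := by rwa [← div_eq_inv_mul, one_le_div₀ ha]
    rw [hnorm]
    linarith

lemma isBigO_add_ofReal_cpow_neg {a s : ℝ} (ha : 0 < a) (hs : 1 ≤ s) :
    (fun z : ℂ => (z + a) ^ ((-s : ℝ) : ℂ)) =O[𝓟 (closure rightHalfPlane)]
      fun z => (1 + ‖z‖)⁻¹ := by
  have hinv (z : ℂ) : 0 ≤ (1 + ‖z‖)⁻¹ := by positivity
  have hpow := (isTheta_add_ofReal ha).inv.isBigO.norm_left.rpow (zero_le_one.trans hs)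
    (Eventually.of_forall hinv)
  refine (IsBigO.of_norm_le fun z => ?_).trans (hpow.trans (isBigO_of_le _ fun z => ?_))
  · rw [norm_cpow_real, Real.rpow_neg (norm_nonneg _), norm_inv, Real.inv_rpow (norm_nonneg _)]
  · rw [Real.norm_of_nonneg (Real.rpow_nonneg (hinv z) _), Real.norm_of_nonneg (hinv z)]
    exact Real.rpow_le_self_of_le_one (hinv z)
      (inv_le_one_of_one_le₀ (le_add_of_nonneg_right (norm_nonneg z))) hs

/-! ### The Schrödinger evolution of a Gaussian -/

section Schrodinger

variable {d : ℕ}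

lemma fourier_gaussianData (ξ : EuclideanSpace ℝ (Fin d)) :
    𝓕 (gaussianData d) ξ = (π / (1 / 4 : ℂ)) ^ (d / 2 : ℂ) *
      cexp (-π ^ 2 * ‖ξ‖ ^ 2 / (1 / 4 : ℂ)) := by
  have h : gaussianData d = fun x => cexp (-(1 / 4 : ℂ) * ‖x‖ ^ 2) := by
    ext x
    rw [gaussianData, ofReal_exp]
    congr 1
    push_cast
    ring
  rw [h, fourier_gaussian_innerProductSpace (by norm_num), finrank_euclideanSpace, Fintype.card_fin]

lemma schrodingerPropagator_gaussianData (t : ℝ) (x : EuclideanSpace ℝ (Fin d)) :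
    schrodingerPropagator t (gaussianData d) x =
      (π / (1 / 4 : ℂ)) ^ (d / 2 : ℂ) *
        ((π / (4 * π ^ 2 * (1 + t * I))) ^ (d / 2 : ℂ) *
          cexp (-π ^ 2 * ‖x‖ ^ 2 / (4 * π ^ 2 * (1 + t * I)))) := by
  have hre : 0 < (4 * (π : ℂ) ^ 2 * (1 + t * I)).re := by
    rw [show 4 * (π : ℂ) ^ 2 = (4 * π ^ 2 : ℝ) by push_cast; rfl, re_ofReal_mul]
    simp [Real.pi_pos]
  have hmultiplier : (fun ξ : EuclideanSpace ℝ (Fin d) =>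
      cexp (-(4 * (π : ℂ) ^ 2 * I * (t : ℂ) * ((‖ξ‖ ^ 2 : ℝ) : ℂ))) * 𝓕 (gaussianData d) ξ) =
        fun ξ => (π / (1 / 4 : ℂ)) ^ (d / 2 : ℂ) *
          cexp (-(4 * (π : ℂ) ^ 2 * (1 + t * I)) * ‖ξ‖ ^ 2) := by
    ext ξ
    rw [fourier_gaussianData, mul_left_comm, ← Complex.exp_add]
    congr 2
    push_cast
    ring
  have hgaussian := fourier_gaussian_innerProductSpace hre (-x)
  rw [norm_neg, finrank_euclideanSpace, Fintype.card_fin] at hgaussian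
  rw [schrodingerPropagator, hmultiplier, ← hgaussian, Real.fourierInv_eq_fourier_neg,
    Real.fourier_eq, Real.fourier_eq, ← integral_const_mul]
  simp_rw [Circle.smul_def, smul_eq_mul, mul_left_comm]

lemma normSq_one_add_ofReal_mul_I (t : ℝ) : normSq (1 + t * I) = 1 + t ^ 2 := by
  rw [← ofReal_one, normSq_add_mul_I, one_pow]

lemma norm_schrodingerPropagator_gaussianData_sq (t : ℝ) (x : EuclideanSpace ℝ (Fin d)) :
    ‖schrodingerPropagator t (gaussianData d) x‖ ^ 2 =
      (1 + t ^ 2) ^ (-(d / 2 : ℝ)) * Real.exp (-(‖x‖ ^ 2 / (2 * (1 + t ^ 2)))) := by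
  have hne : (1 + t * I : ℂ) ≠ 0 := normSq_pos.1 (by rw [normSq_one_add_ofReal_mul_I]; positivity)
  have hnorm_cpow (w : ℂ) : ‖w ^ (d / 2 : ℂ)‖ = ‖w‖ ^ (d / 2 : ℝ) := by
    rw [← norm_cpow_real]
    push_cast
    rfl
  have hbase : (π : ℂ) / (1 / 4) * (π / (4 * π ^ 2 * (1 + t * I))) = (1 + t * I)⁻¹ := by
    have hπ : (π : ℂ) ≠ 0 := ofReal_ne_zero.2 Real.pi_ne_zero
    field_simp
  have hexponent : (-(π : ℂ) ^ 2 * ‖x‖ ^ 2 / (4 * π ^ 2 * (1 + t * I))).re =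
      -(‖x‖ ^ 2 / (4 * (1 + t ^ 2))) := by
    have hπ : (π : ℂ) ≠ 0 := ofReal_ne_zero.2 Real.pi_ne_zero
    have : -(π : ℂ) ^ 2 * ‖x‖ ^ 2 / (4 * π ^ 2 * (1 + t * I)) =
        ((-(‖x‖ ^ 2 / 4) : ℝ) : ℂ) * (1 + t * I)⁻¹ := by
      push_cast
      field_simp
    rw [this, re_ofReal_mul, inv_re, normSq_one_add_ofReal_mul_I, add_re, one_re, re_ofReal_mul,
      I_re]
    field_simp
    ring
  rw [schrodingerPropagator_gaussianData, norm_mul, norm_mul, hnorm_cpow, hnorm_cpow,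
    Complex.norm_exp, hexponent, ← mul_assoc, ← Real.mul_rpow (norm_nonneg _) (norm_nonneg _),
    ← norm_mul, hbase, mul_pow, Real.rpow_pow_comm (norm_nonneg _), ← normSq_eq_norm_sq, map_inv₀,
    normSq_one_add_ofReal_mul_I, Real.inv_rpow (by positivity), Real.rpow_neg (by positivity),
    ← Real.exp_nat_mul]
  congr 2
  push_cast
  field_simp
  ring

lemma exp_neg_lt_norm_schrodingerPropagator_gaussianData_sq_iff {k t : ℝ}
    {x : EuclideanSpace ℝ (Fin d)} :
    Real.exp (-k) < ‖schrodingerPropagator t (gaussianData d) x‖ ^ 2 ↔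
      ‖x‖ ^ 2 < 2 * (1 + t ^ 2) * (k - d / 2 * Real.log (1 + t ^ 2)) := by
  have hp : 0 < 1 + t ^ 2 := by positivity
  rw [norm_schrodingerPropagator_gaussianData_sq, Real.rpow_def_of_pos hp, ← Real.exp_add,
    Real.exp_lt_exp, mul_comm (2 * (1 + t ^ 2)), ← div_lt_iff₀ (by positivity)]
  constructor <;> intro h <;> linarith

lemma isBounded_setOf_exp_neg_lt (hd : 1 ≤ d) (k : ℝ) :
    IsBounded {p : ℝ × EuclideanSpace ℝ (Fin d) |
      Real.exp (-k) < ‖schrodingerPropagator p.1 (gaussianData d) p.2‖ ^ 2} := by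
  have hd₀ : (0 : ℝ) < d := by exact_mod_cast hd
  set R := Real.exp (2 * k / d)
  have htime : IsBounded (Metric.closedBall (0 : ℝ) √R) := Metric.isBounded_closedBall
  have hspace : IsBounded (Metric.closedBall (0 : EuclideanSpace ℝ (Fin d)) √(2 * R * k)) :=
    Metric.isBounded_closedBall
  refine (htime.prod hspace).subset ?_
  rintro ⟨t, x⟩ htx
  have hlt := exp_neg_lt_norm_schrodingerPropagator_gaussianData_sq_iff.1 htx
  have hp : 0 < 1 + t ^ 2 := by positivity
  have hlog : 0 ≤ Real.log (1 + t ^ 2) := Real.log_nonneg (by nlinarith)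
  have hdiff : 0 < k - d / 2 * Real.log (1 + t ^ 2) :=
    pos_of_mul_pos_right ((sq_nonneg _).trans_lt hlt) (by positivity)
  have ht : 1 + t ^ 2 ≤ R := by
    rw [← Real.log_le_iff_le_exp hp, le_div_iff₀ hd₀]
    linarith
  have hx : ‖x‖ ^ 2 ≤ 2 * R * k := by
    refine hlt.le.trans (mul_le_mul (by linarith) ?_ hdiff.le (by positivity))
    exact sub_le_self _ (by positivity)
  simp only [mem_prod, mem_closedBall_zero_iff]
  exact ⟨Real.abs_le_sqrt (by linarith), Real.le_sqrt_of_sq_le hx⟩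

lemma gaussianDistribution_lt_top (hd : 1 ≤ d) {lam : ℝ} (hlam : 0 < lam) :
    gaussianDistribution d lam < ⊤ := by
  have h := (isBounded_setOf_exp_neg_lt hd (-Real.log lam)).measure_lt_top (μ := volume)
  rwa [neg_neg, Real.exp_log hlam] at h

lemma volume_setOf_exp_neg_lt (hd : 1 ≤ d) (k t : ℝ) :
    volume {x : EuclideanSpace ℝ (Fin d) |
      Real.exp (-k) < ‖schrodingerPropagator t (gaussianData d) x‖ ^ 2} =
    ENNReal.ofReal ((2 * π * (1 + t ^ 2)) ^ (d / 2 : ℝ) / Real.Gamma (d / 2 + 1) *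
      max (k - d / 2 * Real.log (1 + t ^ 2)) 0 ^ (d / 2 : ℝ)) := by
  have : Nonempty (Fin d) := ⟨⟨0, hd⟩⟩
  have hball : {x : EuclideanSpace ℝ (Fin d) |
      Real.exp (-k) < ‖schrodingerPropagator t (gaussianData d) x‖ ^ 2} =
      Metric.ball 0 √(2 * (1 + t ^ 2) * max (k - d / 2 * Real.log (1 + t ^ 2)) 0) := by
    ext x
    rw [mem_ofPred_eq, exp_neg_lt_norm_schrodingerPropagator_gaussianData_sq_iff,
      mem_ball_zero_iff, Real.lt_sqrt (norm_nonneg _), mul_max_of_nonneg _ _ (by positivity),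
      mul_zero, lt_max_iff, or_iff_left (sq_nonneg _).not_gt]
  have hpow {y : ℝ} (hy : 0 ≤ y) : √y ^ d = y ^ (d / 2 : ℝ) := by
    rw [Real.sqrt_eq_rpow, ← Real.rpow_natCast, ← Real.rpow_mul hy]
    congr 1
    ring
  rw [hball, EuclideanSpace.volume_ball, Fintype.card_fin,
    ← ENNReal.ofReal_pow (Real.sqrt_nonneg _), ← ENNReal.ofReal_mul (by positivity),
    hpow (by positivity), hpow (by positivity), Real.mul_rpow (by positivity) (by positivity),
    mul_right_comm 2 π, Real.mul_rpow (by positivity) Real.pi_pos.le]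
  congr 1
  ring

lemma gaussianDistribution_exp_neg (hd : 1 ≤ d) (k : ℝ) :
    gaussianDistribution d (Real.exp (-k)) =
      ∫⁻ t : ℝ, ENNReal.ofReal ((2 * π * (1 + t ^ 2)) ^ (d / 2 : ℝ) / Real.Gamma (d / 2 + 1) *
        max (k - d / 2 * Real.log (1 + t ^ 2)) 0 ^ (d / 2 : ℝ)) := by
  have hmeas : MeasurableSet {p : ℝ × EuclideanSpace ℝ (Fin d) |
      Real.exp (-k) < ‖schrodingerPropagator p.1 (gaussianData d) p.2‖ ^ 2} := by
    simp_rw [norm_schrodingerPropagator_gaussianData_sq]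
    exact measurableSet_lt measurable_const (by fun_prop)
  rw [gaussianDistribution, Measure.volume_eq_prod, Measure.prod_apply hmeas]
  exact lintegral_congr fun t => volume_setOf_exp_neg_lt hd k t

end Schrodinger

lemma lintegral_exp_neg_mul_mul_max_sub_rpow {p w s : ℝ} (hp : 0 < p) (hw : 0 < w) (hs : 0 ≤ s) :
    ∫⁻ k in Ioi (0 : ℝ), ENNReal.ofReal (Real.exp (-(k * w)) * max (k - s) 0 ^ p) =
      ENNReal.ofReal (Real.exp (-(s * w)) * ((1 / w) ^ (p + 1) * Real.Gamma (p + 1))) := by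
  have hsupport {r : ℝ} (hr : r ≤ s) : (fun k => ENNReal.ofReal
      (Real.exp (-(k * w)) * max (k - s) 0 ^ p)).support ⊆ Ioi r := fun k hk => by
    by_contra hkr
    have hks : k - s ≤ 0 := by linarith [not_lt.1 (show ¬r < k from hkr)]
    exact hk (by simp [max_eq_right hks, Real.zero_rpow hp.ne'])
  have hshift : ∀ j ∈ Ioi (0 : ℝ), Real.exp (-((j + s) * w)) * max (j + s - s) 0 ^ p =
      Real.exp (-(s * w)) * (j ^ (p + 1 - 1) * Real.exp (-(w * j))) := fun j hj => by
    rw [add_sub_cancel_right, add_sub_cancel_right, max_eq_left (le_of_lt hj), mul_left_comm,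
      ← Real.exp_add, mul_comm]
    ring_nf
  have hGamma := Real.integral_rpow_mul_exp_neg_mul_Ioi (a := p + 1) (by linarith) hw
  have hint : IntegrableOn (fun j : ℝ => j ^ (p + 1 - 1) * Real.exp (-(w * j))) (Ioi 0) := by
    refine not_imp_comm.1 integral_undef (hGamma ▸ ne_of_gt ?_)
    exact mul_pos (by positivity) (Real.Gamma_pos_of_pos (by linarith))
  rw [setLIntegral_eq_of_support_subset (hsupport hs), ← lintegral_add_right_eq_self _ s,
    ← setLIntegral_eq_of_support_subset (s := Ioi 0) fun j hj => by
      simpa using hsupport le_rfl hj]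
  rw [setLIntegral_congr_fun measurableSet_Ioi fun j hj => by rw [hshift j hj], ← hGamma,
    ← integral_const_mul, ofReal_integral_eq_lintegral_ofReal (hint.const_mul _)]
  filter_upwards [ae_restrict_mem measurableSet_Ioi] with j hj
  have : (0 : ℝ) < j := hj
  positivity

lemma lintegral_exp_neg_mul_mul_gaussianDistribution {d : ℕ} (hd : 1 ≤ d) {w : ℝ} (hw : 0 < w) :
    ∫⁻ k in Ioi (0 : ℝ), ENNReal.ofReal (Real.exp (-(k * w))) *
        gaussianDistribution d (Real.exp (-k)) =
      ∫⁻ t : ℝ, ENNReal.ofReal ((2 * π) ^ (d / 2 : ℝ) * w ^ (-(d / 2 + 1) : ℝ) *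
        (1 + t ^ 2) ^ (-(d / 2 * (w - 1)))) := by
  have hd₀ : (0 : ℝ) < d / 2 := by positivity
  have : 0 < Real.Gamma (d / 2 + 1) := Real.Gamma_pos_of_pos (by positivity)
  have hfactor (k t : ℝ) : ENNReal.ofReal (Real.exp (-(k * w))) *
      ENNReal.ofReal ((2 * π * (1 + t ^ 2)) ^ (d / 2 : ℝ) / Real.Gamma (d / 2 + 1) *
        max (k - d / 2 * Real.log (1 + t ^ 2)) 0 ^ (d / 2 : ℝ)) =
      ENNReal.ofReal ((2 * π * (1 + t ^ 2)) ^ (d / 2 : ℝ) / Real.Gamma (d / 2 + 1)) *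
        ENNReal.ofReal (Real.exp (-(k * w)) *
          max (k - d / 2 * Real.log (1 + t ^ 2)) 0 ^ (d / 2 : ℝ)) := by
    rw [← ENNReal.ofReal_mul (by positivity), ← ENNReal.ofReal_mul (by positivity), mul_left_comm]
  simp_rw [gaussianDistribution_exp_neg hd]
  simp_rw [← lintegral_const_mul' _ _ ENNReal.ofReal_ne_top, hfactor]
  rw [lintegral_lintegral_swap (by fun_prop)]
  refine lintegral_congr fun t => ?_
  have hp : 0 < 1 + t ^ 2 := by positivity
  have hlog : 0 ≤ Real.log (1 + t ^ 2) := Real.log_nonneg (by nlinarith)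
  rw [lintegral_const_mul' _ _ ENNReal.ofReal_ne_top,
    lintegral_exp_neg_mul_mul_max_sub_rpow hd₀ hw (by positivity),
    ← ENNReal.ofReal_mul (by positivity)]
  congr 1
  have hexp : Real.exp (-(d / 2 * Real.log (1 + t ^ 2) * w)) = (1 + t ^ 2) ^ (-(d / 2 * w)) := by
    rw [Real.rpow_def_of_pos hp]
    ring_nf
  have hpow : (1 + t ^ 2) ^ (-(d / 2 * (w - 1))) =
      (1 + t ^ 2) ^ (-(d / 2 * w)) * (1 + t ^ 2) ^ (d / 2 : ℝ) := by
    rw [← Real.rpow_add hp]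
    ring_nf
  rw [hexp, hpow, Real.mul_rpow (by positivity) hp.le, one_div, Real.inv_rpow hw.le,
    Real.rpow_neg hw.le]
  field_simp

/-! ### Laplace transforms -/

section LaplaceTransform

variable {v : ℝ → ℝ} {a : ℝ}
  (hv_meas : Measurable v) (hv : ∀ k, 0 ≤ v k)
  (hint : ∀ x : ℝ, a < x → IntegrableOn (fun k => Real.exp (-(k * x)) * v k) (Ioi 0))
include hv_meas hv hint

lemma integrableOn_cexp_mul_of_lt_re {z : ℂ} (hz : a < z.re) :
    IntegrableOn (fun k : ℝ => cexp (-((k : ℂ) * z)) * (v k : ℂ)) (Ioi 0) := by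
  refine (hint z.re hz).mono' (Measurable.aestronglyMeasurable (by fun_prop)) ?_
  refine ae_of_all _ fun k => ?_
  rw [norm_mul, Complex.norm_exp, norm_real, Real.norm_of_nonneg (hv k)]
  simp

lemma differentiableOn_laplaceTransform :
    DifferentiableOn ℂ (laplaceTransform v) {z | a < z.re} := by
  set ν := (volume.restrict (Ioi 0)).withDensity fun k => ENNReal.ofReal (v k)
  have hmgf : laplaceTransform v = ProbabilityTheory.complexMGF (fun k : ℝ => -k) ν := by
    ext z
    rw [laplaceTransform, ProbabilityTheory.complexMGF,
      integral_withDensity_eq_integral_toReal_smul hv_meas.ennreal_ofReal (by simp)]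
    congr 1
    ext k
    rw [ENNReal.toReal_ofReal (hv k), real_smul, mul_comm]
    push_cast
    ring_nf
  have hmem {x : ℝ} (hx : a < x) : x ∈ ProbabilityTheory.integrableExpSet (fun k : ℝ => -k) ν := by
    rw [ProbabilityTheory.integrableExpSet, mem_ofPred_eq,
      integrable_withDensity_iff_integrable_smul' hv_meas.ennreal_ofReal (by simp)]
    refine (hint x hx).congr (ae_of_all _ fun k => ?_)
    simp only
    rw [ENNReal.toReal_ofReal (hv k), smul_eq_mul, mul_comm]
    ring_nf
  rw [hmgf]
  refine ProbabilityTheory.differentiableOn_complexMGF.mono fun z hz => ?_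
  exact mem_interior.2 ⟨Ioi a, fun x hx => hmem hx, isOpen_Ioi, hz⟩

lemma eqOn_laplaceTransform_of_ofReal {F : ℂ → ℂ} (hF : DifferentiableOn ℂ F {z | a < z.re})
    (heq : ∀ x : ℝ, a < x → laplaceTransform v x = F x) :
    EqOn (laplaceTransform v) F {z | a < z.re} := by
  have hopen : IsOpen {z : ℂ | a < z.re} := isOpen_lt continuous_const continuous_re
  have hofReal : Tendsto ((↑) : ℝ → ℂ) (𝓝[≠] (a + 1)) (𝓝[≠] ((a + 1 : ℝ) : ℂ)) :=
    continuous_ofReal.continuousAt.continuousWithinAt.tendsto_nhdsWithin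
      fun x hx => by simpa only [mem_compl_iff, mem_singleton_iff, ofReal_inj] using hx
  refine ((differentiableOn_laplaceTransform hv_meas hv hint).analyticOnNhd
    hopen).eqOn_of_preconnected_of_frequently_eq (hF.analyticOnNhd hopen)
    (convex_halfSpace_re_gt a).isPreconnected (show a < ((a + 1 : ℝ) : ℂ).re by simp)
    (hofReal.frequently (Eventually.frequently ?_))
  filter_upwards [mem_nhdsWithin_of_mem_nhds (Ioi_mem_nhds (lt_add_one a))] with x hx
  exact heq x hx

end LaplaceTransform

lemma laplaceTransform_ofReal (v : ℝ → ℝ) (x : ℝ) :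
    laplaceTransform v x = (∫ k in Ioi (0 : ℝ), Real.exp (-(k * x)) * v k : ℝ) := by
  rw [laplaceTransform, ← integral_complex_ofReal]
  push_cast
  rfl

lemma measurable_weightFunction (d : ℕ) (c : ℝ) : Measurable (weightFunction d c) := by
  have hanti : Antitone (gaussianDistribution d) :=
    fun _ _ h => measure_mono fun _ hp => lt_of_le_of_lt h hp
  have hmeas : Measurable fun k : ℝ => gaussianDistribution d (Real.exp (-k)) :=
    hanti.measurable.comp (by fun_prop)
  exact Measurable.mul (by fun_prop) hmeas.ennreal_toReal

lemma weightFunction_nonneg (d : ℕ) (c k : ℝ) : 0 ≤ weightFunction d c k :=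
  mul_nonneg (Real.exp_pos _).le ENNReal.toReal_nonneg

/-- The first argument of the Beta function in the closed form of the Laplace transform of
`weightFunction d c`. -/
noncomputable def betaArgument (d : ℕ) (c : ℝ) (z : ℂ) : ℂ := d / 2 * (z + c - 1) - 1 / 2

/-- The branch of `log V` on the half-plane `1 + 1 / d < re z + c`, where `V` is the Laplace
transform of `weightFunction d c`, that is built from the principal logarithms of the factors of
`V`. -/
noncomputable def logLaplace (d : ℕ) (c : ℝ) (z : ℂ) : ℂ :=
  (d / 2 * Real.log (2 * π) : ℝ) - (d / 2 + 1) * log (z + c) +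
    log (betaIntegral (betaArgument d c z) (1 / 2))

section WeightFunction

variable {d : ℕ} {c : ℝ} {z : ℂ} (hd : 1 ≤ d)

lemma re_betaArgument (d : ℕ) (c : ℝ) (z : ℂ) :
    (betaArgument d c z).re = d / 2 * (z.re + c - 1) - 1 / 2 := by
  rw [betaArgument, show (d : ℂ) / 2 = (d / 2 : ℝ) by push_cast; rfl, sub_re, re_ofReal_mul]
  simp

lemma differentiable_betaArgument (d : ℕ) (c : ℝ) : Differentiable ℂ (betaArgument d c) := by
  unfold betaArgument
  fun_prop

lemma add_ofReal_mem_slitPlane (hz : 1 + 1 / (d : ℝ) < z.re + c) : z + c ∈ slitPlane := by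
  have : 0 ≤ 1 / (d : ℝ) := by positivity
  exact Or.inl (by simpa using by linarith)

lemma lt_re_add_of_mem_closure (hc : 1 + 1 / (d : ℝ) < c) (hz : z ∈ closure rightHalfPlane) :
    1 + 1 / (d : ℝ) < z.re + c :=
  hc.trans_le (le_add_of_nonneg_left (mem_closure_rightHalfPlane.1 hz))

include hd

lemma half_lt_mul_sub_one {w : ℝ} (hw : 1 + 1 / (d : ℝ) < w) : 1 / 2 < d / 2 * (w - 1) := by
  have hd₀ : (0 : ℝ) < d := by exact_mod_cast hd
  have : 1 / (d : ℝ) < w - 1 := by linarith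
  rw [div_lt_iff₀ hd₀] at this
  linarith

lemma re_betaArgument_pos (hz : 1 + 1 / (d : ℝ) < z.re + c) : 0 < (betaArgument d c z).re := by
  rw [re_betaArgument]
  linarith [half_lt_mul_sub_one hd hz]

lemma lintegral_exp_neg_mul_mul_weightFunction {x : ℝ} (hx : 1 + 1 / (d : ℝ) < x + c) :
    ∫⁻ k in Ioi (0 : ℝ), ENNReal.ofReal (Real.exp (-(k * x)) * weightFunction d c k) =
      ENNReal.ofReal ((2 * π) ^ (d / 2 : ℝ) * (x + c) ^ (-(d / 2 + 1) : ℝ) *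
        ∫ t : ℝ, (1 + t ^ 2) ^ (-(d / 2 * (x + c - 1)))) := by
  have hxc : 0 < x + c := by linarith [show 0 ≤ 1 / (d : ℝ) by positivity]
  have hweight (k : ℝ) : ENNReal.ofReal (Real.exp (-(k * x)) * weightFunction d c k) =
      ENNReal.ofReal (Real.exp (-(k * (x + c)))) * gaussianDistribution d (Real.exp (-k)) := by
    rw [weightFunction, ← mul_assoc, ← Real.exp_add, ENNReal.ofReal_mul (Real.exp_pos _).le,
      ENNReal.ofReal_toReal (gaussianDistribution_lt_top hd (Real.exp_pos _)).ne]
    ring_nf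
  simp_rw [hweight]
  rw [lintegral_exp_neg_mul_mul_gaussianDistribution hd hxc, ← integral_const_mul,
    ofReal_integral_eq_lintegral_ofReal
      ((integrable_one_add_sq_rpow_neg (half_lt_mul_sub_one hd hx)).const_mul _)]
  exact ae_of_all _ fun t => by positivity

lemma integrableOn_exp_neg_mul_mul_weightFunction {x : ℝ} (hx : 1 + 1 / (d : ℝ) < x + c) :
    IntegrableOn (fun k : ℝ => Real.exp (-(k * x)) * weightFunction d c k) (Ioi 0) := by
  have hmeas := measurable_weightFunction d c
  refine (lintegral_ofReal_ne_top_iff_integrable (Measurable.aestronglyMeasurable (by fun_prop))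
    (ae_of_all _ fun k => mul_nonneg (Real.exp_pos _).le (weightFunction_nonneg d c k))).1 ?_
  rw [lintegral_exp_neg_mul_mul_weightFunction hd hx]
  exact ENNReal.ofReal_ne_top

lemma integral_exp_neg_mul_mul_weightFunction {x : ℝ} (hx : 1 + 1 / (d : ℝ) < x + c) :
    ∫ k in Ioi (0 : ℝ), Real.exp (-(k * x)) * weightFunction d c k =
      (2 * π) ^ (d / 2 : ℝ) * (x + c) ^ (-(d / 2 + 1) : ℝ) *
        ∫ t : ℝ, (1 + t ^ 2) ^ (-(d / 2 * (x + c - 1))) := by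
  have hxc : 0 < x + c := by linarith [show 0 ≤ 1 / (d : ℝ) by positivity]
  have : 0 ≤ ∫ t : ℝ, (1 + t ^ 2) ^ (-((d : ℝ) / 2 * (x + c - 1))) :=
    integral_nonneg fun t => by positivity
  rw [integral_eq_lintegral_of_nonneg_ae
    (ae_of_all _ fun k => mul_nonneg (Real.exp_pos _).le (weightFunction_nonneg d c k))
    (integrableOn_exp_neg_mul_mul_weightFunction hd hx).aestronglyMeasurable,
    lintegral_exp_neg_mul_mul_weightFunction hd hx, ENNReal.toReal_ofReal (by positivity)]

lemma integrableOn_cexp_mul_weightFunction (hz : 1 + 1 / (d : ℝ) < z.re + c) :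
    IntegrableOn (fun k : ℝ => cexp (-((k : ℂ) * z)) * (weightFunction d c k : ℂ)) (Ioi 0) :=
  integrableOn_cexp_mul_of_lt_re (measurable_weightFunction d c) (weightFunction_nonneg d c)
    (fun _ hx => integrableOn_exp_neg_mul_mul_weightFunction hd (sub_lt_iff_lt_add.1 hx))
    (sub_lt_iff_lt_add.2 hz)

lemma differentiableAt_betaIntegral_betaArgument (hz : 1 + 1 / (d : ℝ) < z.re + c) :
    DifferentiableAt ℂ (fun z => betaIntegral (betaArgument d c z) (1 / 2)) z :=
  (differentiableAt_betaIntegral_left (re_betaArgument_pos hd hz) (by norm_num)).comp z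
    (differentiable_betaArgument d c z)

theorem laplaceTransform_weightFunction (hz : 1 + 1 / (d : ℝ) < z.re + c) :
    laplaceTransform (weightFunction d c) z =
      ((2 * π) ^ (d / 2 : ℝ) : ℝ) * (z + c) ^ ((-(d / 2 + 1) : ℝ) : ℂ) *
        betaIntegral (betaArgument d c z) (1 / 2) := by
  refine eqOn_laplaceTransform_of_ofReal (a := 1 + 1 / (d : ℝ) - c)
    (F := fun z => ((2 * π) ^ (d / 2 : ℝ) : ℝ) * (z + c) ^ ((-(d / 2 + 1) : ℝ) : ℂ) *
        betaIntegral (betaArgument d c z) (1 / 2))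
    (measurable_weightFunction d c) (weightFunction_nonneg d c)
    (fun _ hx => integrableOn_exp_neg_mul_mul_weightFunction hd (sub_lt_iff_lt_add.1 hx))
    (fun z hz => ?_) (fun x hx => ?_) (sub_lt_iff_lt_add.2 hz)
  · have hz : 1 + 1 / (d : ℝ) < z.re + c := sub_lt_iff_lt_add.1 hz
    have hpow : DifferentiableAt ℂ (fun z : ℂ => (z + c) ^ ((-(d / 2 + 1) : ℝ) : ℂ)) z :=
      DifferentiableAt.cpow (by fun_prop) (by fun_prop) (add_ofReal_mem_slitPlane hz)
    exact ((hpow.const_mul _).mul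
      (differentiableAt_betaIntegral_betaArgument hd hz)).differentiableWithinAt
  · have hx := sub_lt_iff_lt_add.1 hx
    have hxc : 0 < x + c := by linarith [show 0 ≤ 1 / (d : ℝ) by positivity]
    have hbeta := integral_one_add_sq_rpow_neg ((d : ℝ) / 2 * (x + c - 1))
    rw [laplaceTransform_ofReal, integral_exp_neg_mul_mul_weightFunction hd hx, ofReal_mul,
      ofReal_mul, hbeta, ofReal_cpow hxc.le]
    simp [betaArgument]

lemma betaIntegral_betaArgument_mem_slitPlane (hz : 1 + 1 / (d : ℝ) < z.re + c) :
    betaIntegral (betaArgument d c z) (1 / 2) ∈ slitPlane := by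
  simpa using betaIntegral_mem_slitPlane (v := 1 / 2) (re_betaArgument_pos hd hz)
    (by norm_num) (by norm_num)

lemma cexp_logLaplace (hz : 1 + 1 / (d : ℝ) < z.re + c) :
    cexp (logLaplace d c z) = laplaceTransform (weightFunction d c) z := by
  have hbeta := slitPlane_ne_zero (betaIntegral_betaArgument_mem_slitPlane hd hz)
  have hzc := slitPlane_ne_zero (add_ofReal_mem_slitPlane hz)
  rw [laplaceTransform_weightFunction hd hz, logLaplace, sub_eq_add_neg, Complex.exp_add,
    Complex.exp_add, exp_log hbeta, cpow_def_of_ne_zero hzc, Real.rpow_def_of_pos (by positivity),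
    ofReal_exp]
  push_cast
  ring_nf

lemma differentiableAt_logLaplace (hz : 1 + 1 / (d : ℝ) < z.re + c) :
    DifferentiableAt ℂ (logLaplace d c) z := by
  have hbeta := (differentiableAt_betaIntegral_betaArgument hd hz).clog
    (betaIntegral_betaArgument_mem_slitPlane hd hz)
  have hlog : DifferentiableAt ℂ (fun z : ℂ => log (z + c)) z :=
    DifferentiableAt.clog (by fun_prop) (add_ofReal_mem_slitPlane hz)
  exact ((hlog.const_mul _).const_sub _).add hbeta

variable (hc : 1 + 1 / (d : ℝ) < c)
include hc

lemma exists_pos_tendsto_betaArgument :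
    ∃ a > 0, Tendsto (betaArgument d c) (𝓟 (closure rightHalfPlane)) (𝓟 {u | a ≤ u.re}) := by
  refine ⟨(betaArgument d c 0).re, re_betaArgument_pos hd (by simpa using hc),
    tendsto_principal_principal.2 fun z hz => ?_⟩
  rw [mem_closure_rightHalfPlane] at hz
  rw [mem_ofPred_eq, re_betaArgument, re_betaArgument, zero_re]
  gcongr

lemma isBigO_one_betaIntegral_betaArgument :
    (fun z => betaIntegral (betaArgument d c z) (1 / 2)) =O[𝓟 (closure rightHalfPlane)]
      fun _ => (1 : ℂ) := by
  obtain ⟨a, ha, htendsto⟩ := exists_pos_tendsto_betaArgument hd hc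
  exact (isBigO_one_betaIntegral_left ha (by norm_num)).comp_tendsto htendsto

lemma isBigO_inv_betaIntegral_betaArgument :
    (fun z => (betaIntegral (betaArgument d c z) (1 / 2))⁻¹) =O[𝓟 (closure rightHalfPlane)]
      fun z => 1 + ‖z‖ := by
  obtain ⟨a, ha, htendsto⟩ := exists_pos_tendsto_betaArgument hd hc
  refine ((isBigO_inv_betaIntegral_left ha (by norm_num) (by norm_num)).comp_tendsto
    htendsto).trans (isBigO_of_le' (c := ‖(d / 2 : ℂ)‖ + ‖betaArgument d c 0‖) _ fun z => ?_)
  have heq : betaArgument d c z = d / 2 * z + betaArgument d c 0 := by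
    rw [betaArgument, betaArgument]
    ring
  rw [Function.comp_apply, heq, Real.norm_of_nonneg (by positivity)]
  refine (norm_add_le _ _).trans ?_
  rw [norm_mul]
  nlinarith [norm_nonneg z, norm_nonneg (d / 2 : ℂ), norm_nonneg (betaArgument d c 0)]

lemma isBigO_logLaplace :
    logLaplace d c =O[𝓟 (closure rightHalfPlane)] fun z => (1 + ‖z‖) ^ (1 / 2 : ℝ) := by
  have hone (z : ℂ) : 1 ≤ 1 + ‖z‖ := le_add_of_nonneg_right (norm_nonneg z)
  have hshift := isTheta_add_ofReal (hc.trans' (by positivity))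
  have hshift_inv : (fun z : ℂ => (z + c)⁻¹) =O[𝓟 (closure rightHalfPlane)] fun z => 1 + ‖z‖ :=
    hshift.inv.isBigO.trans (isBigO_of_le _ fun z => by
      rw [norm_inv, Real.norm_of_nonneg (zero_le_one.trans (hone z))]
      exact (inv_le_one_of_one_le₀ (hone z)).trans (hone z))
  have hlog := isBigO_log_of_isBigO_of_isBigO_inv (one_half_pos (α := ℝ)) hone hshift.isBigO
    hshift_inv
  have hlog_beta := isBigO_log_of_isBigO_of_isBigO_inv (one_half_pos (α := ℝ)) hone
    ((isBigO_one_betaIntegral_betaArgument hd hc).trans (isBigO_const_of_one_le hone 1))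
    (isBigO_inv_betaIntegral_betaArgument hd hc)
  exact ((isBigO_const_of_one_le (fun z => Real.one_le_rpow (hone z) one_half_pos.le) _).sub
    (hlog.const_mul_left _)).add hlog_beta

lemma isBigO_laplaceTransform_weightFunction :
    laplaceTransform (weightFunction d c) =O[𝓟 rightHalfPlane] fun z => (1 + ‖z‖)⁻¹ := by
  have hpow := isBigO_add_ofReal_cpow_neg (a := c) (s := d / 2 + 1) (hc.trans' (by positivity))
    (le_add_of_nonneg_left (by positivity))
  have hbeta := (isBigO_one_betaIntegral_betaArgument hd hc).trans
    (isBigO_const_const 1 (one_ne_zero (α := ℝ)) _)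
  refine (((hpow.const_mul_left (((2 * π) ^ (d / 2 : ℝ) : ℝ) : ℂ)).mul hbeta).mono
    (principal_mono.2 subset_closure)).congr' ?_ (by simp)
  exact eventually_principal.2 fun z hz => (laplaceTransform_weightFunction hd
    (lt_re_add_of_mem_closure hc (subset_closure hz))).symm

end WeightFunction

theorem corollary5p2_general (d : ℕ) (hd : 1 ≤ d) (c : ℝ) (hc : 1 + 1 / (d : ℝ) < c) :
    (∀ lam : ℝ, 0 < lam → gaussianDistribution d lam < ⊤) ∧
    (∀ z ∈ rightHalfPlane, IntegrableOn
      (fun k : ℝ => Complex.exp (-((k : ℂ) * z)) * (weightFunction d c k : ℂ)) (Set.Ioi 0)) ∧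
    MemHardyTwo (laplaceTransform (weightFunction d c)) ∧
    IsOuter (laplaceTransform (weightFunction d c)) := by
  have hre {z : ℂ} (hz : z ∈ closure rightHalfPlane) : 1 + 1 / (d : ℝ) < z.re + c :=
    lt_re_add_of_mem_closure hc hz
  have hexp : EqOn (laplaceTransform (weightFunction d c)) (fun z => cexp (logLaplace d c z))
      rightHalfPlane := fun z hz => (cexp_logLaplace hd (hre (subset_closure hz))).symm
  have hlog : DiffContOnCl ℂ (logLaplace d c) rightHalfPlane :=
    DifferentiableOn.diffContOnCl fun z hz =>
      (differentiableAt_logLaplace hd (hre hz)).differentiableWithinAt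
  have hgrowth := isBigO_logLaplace hd hc
  refine ⟨fun lam hlam => gaussianDistribution_lt_top hd hlam,
    fun z hz => integrableOn_cexp_mul_weightFunction hd (hre (subset_closure hz)),
    memHardyTwo_of_isBigO (hlog.differentiableOn.cexp.congr hexp)
      (isBigO_laplaceTransform_weightFunction hd hc),
    isOuter_of_eqOn_exp hexp hlog (isLittleO_id_of_isBigO_rpow one_half_lt_one hgrowth) ?_⟩
  exact integrable_div_one_add_sq_of_isBigO_rpow one_half_lt_one hgrowth
    (continuous_comp_imaginary_axis hlog.continuousOn) ofReal_mul_I_mem_closure_rightHalfPlane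

theorem corollary5p2 (d : ℕ) (hd : 1 ≤ d) (c : ℝ) (hc : 1 + 3 / (2 * (d : ℝ)) ≤ c) :
    (∀ lam : ℝ, 0 < lam → gaussianDistribution d lam < ⊤) ∧
    (∀ z ∈ rightHalfPlane, IntegrableOn
      (fun k : ℝ => Complex.exp (-((k : ℂ) * z)) * (weightFunction d c k : ℂ)) (Set.Ioi 0)) ∧
    MemHardyTwo (laplaceTransform (weightFunction d c)) ∧
    IsOuter (laplaceTransform (weightFunction d c)) := by
  have hd₀ : 0 < 1 / (d : ℝ) := by positivity
  exact corollary5p2_general d hd c (by linarith [mul_div_mul_comm 3 1 (2 : ℝ) d])
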